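/- All graphs are finite and simple. The order of a graph is its number of vertices, and its size is its number of edges. A graph $G$ is called locally nonforesty if for every vertex $v$ of $G$ the subgraph of $G$ induced by the neighborhood of $v$ contains a cycle. For an integer $n\ge 8$ define $$ p(n)=\begin{cases} 2n-1-\lfloor n/4\rfloor & \text{if } n\equiv 0,3 \pmod 4,\\ 2n-\lfloor n/4\rfloor & \text{otherwise.} \end{cases} $$ Then the minimum size of a connected locally nonforesty graph of order $n$ is $p(n)$; that is, every connected locally nonforesty graph of order $n$ has at least $p(n)$ edges, and there is such a graph with exactly $p(n)$ edges. -/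

import Mathlib

namespace SimpleGraph

/-- The local subgraph of `G` at `v`: the subgraph induced by the neighborhood of `v`. -/
abbrev localSubgraph {V : Type*} (G : SimpleGraph V) (v : V) : SimpleGraph (G.neighborSet v) :=
  G.induce (G.neighborSet v)

/-- `G` is locally nonforesty if every local subgraph of `G` contains a cycle. -/
def LocallyNonforesty {V : Type*} (G : SimpleGraph V) : Prop :=
  ∀ v : V, ∃ (u : G.neighborSet v) (c : (G.localSubgraph v).Walk u u), c.IsCycle

end SimpleGraph

/-- The extremal function `p(n)`. For `n ≥ 1` the natural-number subtractions do not truncate. -/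
def pSize (n : ℕ) : ℕ :=
  if n % 4 = 0 ∨ n % 4 = 3 then 2 * n - 1 - n / 4 else 2 * n - n / 4

/-!
Every vertex `v` is the hub of a wheel: a cycle (the rim) in its neighborhood, joined to `v`. For
the lower bound, a set `S` of vertices is grown one wheel at a time. As `G` is connected, some
`v ∉ S` has a neighbor in `S`. Adding to `S` a wheel around `v` with `t` new vertices brings at
least `3`, `5`, `6` new edges for `t = 1, 2, 3` and at least `2 * t` for larger `t`, because every
new rim vertex brings its spoke and a rim edge, and one rim edge more is new if the rim
meets `S` without lying in `S`. The only exception is a wheel disjoint from `S`, which is attached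
by a single edge and brings `2 * t - 1`. The function `growthCost`, the least total cost of a
composition of `n` into batches that cost `3, 5, 6, 7, 10, 12, 14, …`, is subadditive, equals
`pSize n + 1`, and satisfies `growthCost t ≤ 2 * t - 1` for `t = 4` and `t ≥ 7`. So the exception is
harmless unless the rim has length `4` or `5`. In that case, with the rim chosen as short as
possible, `v` lies in no `K₄`. Let `x` be a rim vertex and `Q` a rim around `x`. If `Q` reaches a
new vertex, adding it makes up for the missing edge or yields at least `8` new vertices in
total. Otherwise all of `Q` is already there, and `x` has a further neighbor besides `v` and its two
neighbors on the rim, which is the missing edge. This is `exists_growth`. The first wheel lacks the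
edge to `S`, whence `pSize n = growthCost n - 1`.

Edges are counted through degree sums of induced subgraphs: `degSum_union` counts what `T` adds
to `A`, and parity (`even_degSum`) turns one surplus neighbor into a full edge.

The extremal graph is a chain of copies of `K₄` linked by single edges, where the last copy shares
`4 - r` vertices with its predecessor if `n` has remainder `r ≠ 0` modulo `4`. With the vertices
numbered along the chain, `i` and `j` are adjacent when they lie in the same block of four, are
consecutive, or are among the last four. Only the upper bound for its size has to be counted.
-/

/-! ### Degree sums and rims -/

namespace SimpleGraph

variable {V : Type*} (G : SimpleGraph V)

open Finset

open Classical in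
/-- The number of neighbors of `x` in the finite set `A`; the vertex `x` may lie in `A` or not. -/
noncomputable def degIn (x : V) (A : Finset V) : ℕ := #{y ∈ A | G.Adj x y}

/-- The sum of the degrees in the subgraph induced by `A`, which is twice its number of edges. -/
noncomputable def degSum (A : Finset V) : ℕ := ∑ x ∈ A, G.degIn x A

/-- What the argument uses about the vertex set of a cycle: every vertex has at least two neighbors
in `R`, and every partition of `R` into two nonempty parts is crossed by an edge. Chords are
allowed. -/
structure IsRim (R : Finset V) : Prop where
  nonempty : R.Nonempty
  two_le_degIn : ∀ x ∈ R, 2 ≤ G.degIn x R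
  exists_adj : ∀ T ⊆ R, T.Nonempty → T ≠ R → ∃ x ∈ T, ∃ y ∈ R, y ∉ T ∧ G.Adj x y

variable {G}

lemma degIn_mono (x : V) {A B : Finset V} (h : A ⊆ B) : G.degIn x A ≤ G.degIn x B := by
  classical
  exact card_le_card (filter_subset_filter _ h)

lemma degIn_pos {x y : V} {A : Finset V} (hy : y ∈ A) (h : G.Adj x y) : 0 < G.degIn x A := by
  classical
  exact card_pos.2 ⟨y, mem_filter.2 ⟨hy, h⟩⟩

lemma degIn_eq_card {x : V} {A : Finset V} (h : ∀ y ∈ A, G.Adj x y) : G.degIn x A = #A := by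
  classical
  rw [degIn, filter_true_of_mem h]

lemma degIn_eq_sum [DecidableRel G.Adj] (x : V) (A : Finset V) :
    G.degIn x A = ∑ y ∈ A, if G.Adj x y then 1 else 0 := by
  classical
  rw [degIn, card_filter]
  exact sum_congr rfl fun y _ ↦ by congr

lemma degIn_union [DecidableEq V] (x : V) {A B : Finset V} (h : Disjoint A B) :
    G.degIn x (A ∪ B) = G.degIn x A + G.degIn x B := by
  classical
  simp only [degIn_eq_sum, sum_union h]

lemma sum_degIn_comm (A B : Finset V) : ∑ x ∈ A, G.degIn x B = ∑ x ∈ B, G.degIn x A := by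
  classical
  simp only [degIn_eq_sum]
  rw [sum_comm]
  simp only [G.adj_comm]

lemma degSum_union [DecidableEq V] {A T : Finset V} (h : Disjoint A T) :
    G.degSum (A ∪ T) = G.degSum A + ∑ x ∈ T, (G.degIn x T + 2 * G.degIn x A) := by
  simp only [degSum, sum_union h, degIn_union _ h, sum_add_distrib, ← mul_sum]
  rw [sum_degIn_comm A T]
  ring

lemma degIn_self (x : V) : G.degIn x {x} = 0 := by
  classical
  simp [degIn_eq_sum]

lemma degSum_insert [DecidableEq V] {A : Finset V} {v : V} (hv : v ∉ A) :
    G.degSum (insert v A) = G.degSum A + 2 * G.degIn v A := by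
  rw [insert_eq, union_comm, degSum_union (by simpa using hv)]
  simp [degIn_self]

lemma even_degSum (A : Finset V) : Even (G.degSum A) := by
  classical
  induction A using Finset.induction_on with
  | empty => simp [degSum]
  | insert v A hv ih => rw [degSum_insert hv]; exact ih.add (even_two_mul _)

lemma degSum_univ [Fintype V] : G.degSum univ = 2 * G.edgeSet.ncard := by
  classical
  rw [← coe_edgeFinset, Set.ncard_coe_finset, ← sum_degrees_eq_twice_card_edges]
  refine sum_congr rfl fun x _ ↦ ?_
  rw [degIn, ← card_neighborFinset_eq_degree, neighborFinset_eq_filter]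

lemma degIn_le_card_sub_one {x : V} {A : Finset V} (hx : x ∈ A) : G.degIn x A ≤ #A - 1 := by
  classical
  rw [← card_erase_of_mem hx]
  exact card_le_card fun y hy ↦ by
    rw [mem_filter] at hy
    exact mem_erase.2 ⟨hy.2.ne', hy.1⟩

lemma IsRim.three_le_card {R : Finset V} (h : G.IsRim R) : 3 ≤ #R := by
  obtain ⟨x, hx⟩ := h.nonempty
  have h1 := h.two_le_degIn x hx
  have h2 := G.degIn_le_card_sub_one hx
  omega

lemma IsRim.adj_of_card_eq_three {R : Finset V} (h : G.IsRim R) (hR : #R = 3) {x y : V}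
    (hx : x ∈ R) (hy : y ∈ R) (hxy : x ≠ y) : G.Adj x y := by
  classical
  by_contra hadj
  have h1 := h.two_le_degIn x hx
  have : G.degIn x R ≤ #((R.erase x).erase y) := card_le_card fun z hz ↦ by
    rw [mem_filter] at hz
    refine mem_erase.2 ⟨?_, mem_erase.2 ⟨hz.2.ne', hz.1⟩⟩
    rintro rfl
    exact hadj hz.2
  rw [card_erase_of_mem (mem_erase.2 ⟨hxy.symm, hy⟩), card_erase_of_mem hx] at this
  omega

lemma isRim_triangle [DecidableEq V] {a b c : V} (hab : G.Adj a b) (hac : G.Adj a c)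
    (hbc : G.Adj b c) : G.IsRim {a, b, c} := by
  have hadj : ∀ x ∈ ({a, b, c} : Finset V), ∀ y ∈ ({a, b, c} : Finset V), y ≠ x → G.Adj x y := by
    intro x hx y hy hxy
    simp only [mem_insert, mem_singleton] at hx hy
    rcases hx with rfl | rfl | rfl <;> rcases hy with rfl | rfl | rfl <;>
      first | exact absurd rfl hxy | assumption | (apply Adj.symm; assumption)
  refine ⟨by simp, fun x hx ↦ ?_, fun T hT hne hTR ↦ ?_⟩
  · have h3 : #({a, b, c} : Finset V) = 3 := card_eq_three.2 ⟨a, b, c, hab.ne, hac.ne, hbc.ne, rfl⟩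
    have h1 : G.degIn x (({a, b, c} : Finset V).erase x) = _ :=
      degIn_eq_card fun y hy ↦ hadj x hx y (mem_of_mem_erase hy) (ne_of_mem_erase hy)
    rw [card_erase_of_mem hx, h3] at h1
    exact h1.symm.le.trans (G.degIn_mono x (erase_subset _ _))
  · obtain ⟨x, hx⟩ := hne
    obtain ⟨y, hy, hyT⟩ := exists_of_ssubset (hT.ssubset_of_ne hTR)
    exact ⟨x, hx, y, hy, hyT, hadj x (hT hx) y hy fun h ↦ hyT (h ▸ hx)⟩

lemma LocallyNonforesty.exists_isRim (h : G.LocallyNonforesty) (v : V) :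
    ∃ R : Finset V, G.IsRim R ∧ ∀ x ∈ R, G.Adj v x := by
  classical
  obtain ⟨u, c, hc⟩ := h v
  have hmem : ∀ x, x ∈ c.support.toFinset.map (Function.Embedding.subtype _) ↔
      ∃ y ∈ c.support, y.1 = x := by simp
  refine ⟨c.support.toFinset.map (Function.Embedding.subtype _), ⟨?_, ?_, ?_⟩, ?_⟩
  · exact ⟨u, (hmem _).2 ⟨u, c.start_mem_support, rfl⟩⟩
  · intro x hx
    obtain ⟨y, hy, rfl⟩ := (hmem x).1 hx
    rw [← hc.ncard_neighborSet_toSubgraph_eq_two hy,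
      ← Set.ncard_image_of_injective _ Subtype.val_injective, degIn, ← Set.ncard_coe_finset]
    refine Set.ncard_le_ncard ?_ (finite_toSet _)
    rintro _ ⟨z, hz, rfl⟩
    have hz : c.toSubgraph.Adj y z := hz
    exact mem_coe.2 <| mem_filter.2
      ⟨(hmem _).2 ⟨z, c.mem_verts_toSubgraph.1 hz.snd_mem, rfl⟩, hz.adj_sub⟩
  · rintro T hT ⟨x, hx⟩ hTR
    obtain ⟨z, hz, hzT⟩ := exists_of_ssubset (hT.ssubset_of_ne hTR)
    obtain ⟨x, hxc, rfl⟩ := (hmem x).1 (hT hx)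
    obtain ⟨z, hzc, rfl⟩ := (hmem z).1 hz
    -- The part of the cycle that leads from `x` to `z` has to leave `T`.
    have hzr : z ∈ (c.rotate x hxc).support := by simpa using hzc
    obtain ⟨d, hd, hd1, hd2⟩ := ((c.rotate x hxc).takeUntil z hzr).exists_boundary_dart
      {w | w.1 ∈ T} hx hzT
    have hds := Walk.support_takeUntil_subset_support _ hzr
      (Walk.dart_snd_mem_support_of_mem_darts _ hd)
    refine ⟨d.fst, hd1, d.snd, (hmem _).2 ⟨d.snd, by simpa using hds, rfl⟩, hd2, d.adj⟩
  · intro x hx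
    obtain ⟨y, -, rfl⟩ := (hmem x).1 hx
    exact y.2

end SimpleGraph

/-! ### The lower bound -/

/-- The least total cost of `t` vertices split into batches, when a batch of `s` vertices costs `3`,
`5`, `6`, `7` for `s = 1, 2, 3, 4` and `2 * s` for larger `s`. It is `pSize t + 1` for `t ≥ 1`:
the cost of a batch includes the edge that attaches it to earlier batches, which the first batch
lacks. -/
def growthCost (t : ℕ) : ℕ := 2 * t - t / 4 + if t % 4 = 1 ∨ t % 4 = 2 then 1 else 0

lemma growthCost_add_le (a b : ℕ) : growthCost (a + b) ≤ growthCost a + growthCost b := by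
  unfold growthCost
  split_ifs <;> omega

lemma growthCost_le_two_mul {t : ℕ} (ht : 3 ≤ t) : growthCost t ≤ 2 * t := by
  unfold growthCost
  split_ifs <;> omega

lemma growthCost_le_two_mul_sub_one {t : ℕ} (ht : t = 4 ∨ 7 ≤ t) :
    growthCost t ≤ 2 * t - 1 := by
  unfold growthCost
  split_ifs <;> omega

lemma pSize_add_one {n : ℕ} (hn : 1 ≤ n) : pSize n + 1 = growthCost n := by
  unfold growthCost pSize
  split_ifs <;> omega

namespace SimpleGraph

variable {V : Type*} {G : SimpleGraph V}

open Finset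

/-- A rim vertex outside `A` sees the hub `h ∈ A` and at least two rim vertices; the neighbors in
`A` count twice in `degSum_union`. -/
lemma IsRim.four_add_le [DecidableEq V] {A R : Finset V} (hR : G.IsRim R) {h : V} (hA : h ∈ A)
    (hh : ∀ x ∈ R, G.Adj h x) {x : V} (hx : x ∈ R) :
    4 + G.degIn x (R ∩ A) ≤ G.degIn x (R \ A) + 2 * G.degIn x A := by
  have h1 := hR.two_le_degIn x hx
  rw [← sdiff_union_inter R A, degIn_union x (disjoint_sdiff_inter R A)] at h1
  have hhR : h ∉ R := fun hc ↦ (hh h hc).ne rfl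
  have h2 : G.degIn x ({h} ∪ R ∩ A) ≤ G.degIn x A := G.degIn_mono x <| by
    intro y hy
    simp only [mem_union, mem_singleton, mem_inter] at hy
    rcases hy with rfl | hy
    exacts [hA, hy.2]
  rw [degIn_union x (by simp [hhR])] at h2
  have h3 : 0 < G.degIn x {h} := G.degIn_pos (mem_singleton_self h) (hh x hx).symm
  omega

lemma IsRim.degSum_add_le [DecidableEq V] {A R : Finset V} (hR : G.IsRim R) {h : V} (hA : h ∈ A)
    (hh : ∀ x ∈ R, G.Adj h x) : G.degSum A + 4 * #(R \ A) ≤ G.degSum (A ∪ R) := by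
  rw [← union_sdiff_self_eq_union, degSum_union disjoint_sdiff, mul_comm, ← smul_eq_mul]
  refine Nat.add_le_add_left (card_nsmul_le_sum _ _ _ fun x hx ↦ ?_) _
  have := hR.four_add_le hA hh (mem_sdiff.1 hx).1
  omega

/-- A single surplus neighbor improves the bound by a whole edge, because `degSum` is even. -/
lemma IsRim.degSum_add_le_of_five_le [DecidableEq V] {A R : Finset V} (hR : G.IsRim R) {h : V}
    (hA : h ∈ A) (hh : ∀ x ∈ R, G.Adj h x) {x : V} (hx : x ∈ R \ A)
    (h5 : 5 ≤ G.degIn x (R \ A) + 2 * G.degIn x A) :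
    G.degSum A + 4 * #(R \ A) + 2 ≤ G.degSum (A ∪ R) := by
  have hlt : ∑ _x ∈ R \ A, 4 < ∑ x ∈ R \ A, (G.degIn x (R \ A) + 2 * G.degIn x A) := by
    refine sum_lt_sum (fun y hy ↦ ?_) ⟨x, hx, h5⟩
    have := hR.four_add_le hA hh (mem_sdiff.1 hy).1
    omega
  have h1 := degSum_union (G := G) (disjoint_sdiff : Disjoint A (R \ A))
  rw [union_sdiff_self_eq_union] at h1
  rw [sum_const, smul_eq_mul] at hlt
  have h2 := G.even_degSum A
  have h3 := G.even_degSum (A ∪ R)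
  grind

lemma IsRim.degSum_add_le_of_inter_nonempty [DecidableEq V] {A R : Finset V} (hR : G.IsRim R)
    {h : V} (hA : h ∈ A) (hh : ∀ x ∈ R, G.Adj h x) (hd : (R \ A).Nonempty)
    (hi : (R ∩ A).Nonempty) : G.degSum A + 4 * #(R \ A) + 2 ≤ G.degSum (A ∪ R) := by
  obtain ⟨z, hz⟩ := hi
  rw [mem_inter] at hz
  obtain ⟨x, hx, y, hy, hyT, hxy⟩ := hR.exists_adj (R \ A) sdiff_subset hd
    fun h ↦ (mem_sdiff.1 (h ▸ hz.1)).2 hz.2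
  have hyA : y ∈ A := by simpa [hy] using hyT
  refine hR.degSum_add_le_of_five_le hA hh hx ?_
  have h1 := hR.four_add_le hA hh (mem_sdiff.1 hx).1
  have h2 : 0 < G.degIn x (R ∩ A) := G.degIn_pos (mem_inter.2 ⟨hy, hyA⟩) hxy
  omega

/-- If the rim `R` of `v` is not a triangle and no rim of `v` is smaller, then a vertex `x ∈ R`
whose own rim `Q` lies in `A ∪ R` has a neighbor besides `v` and two vertices of `R`: otherwise `Q`
is the set of these three, so that `x` and its two neighbors in `R` form a triangle around `v`. -/
lemma IsRim.five_le_of_subset [DecidableEq V] {A R Q : Finset V} (hR : G.IsRim R) {v x : V}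
    (hA : v ∈ A) (hv : ∀ y ∈ R, G.Adj v y) (h4 : 4 ≤ #R)
    (hmin : ∀ P : Finset V, G.IsRim P → (∀ y ∈ P, G.Adj v y) → #R ≤ #P) (hx : x ∈ R)
    (hRA : Disjoint R A) (hQ : G.IsRim Q) (hxQ : ∀ y ∈ Q, G.Adj x y) (hQA : Q ⊆ A ∪ R) :
    5 ≤ G.degIn x (R \ A) + 2 * G.degIn x A := by
  classical
  rw [sdiff_eq_self_of_disjoint hRA]
  by_contra hlt
  have h1 := hR.two_le_degIn x hx
  have h2 : 0 < G.degIn x A := G.degIn_pos hA (hv x hx).symm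
  have h3 := G.degIn_union x hRA.symm
  have hQ3 := hQ.three_le_card
  have hsub : Q ⊆ {y ∈ A ∪ R | G.Adj x y} := fun y hy ↦ mem_filter.2 ⟨hQA hy, hxQ y hy⟩
  have hle : #{y ∈ A ∪ R | G.Adj x y} ≤ 3 := by
    change G.degIn x (A ∪ R) ≤ 3
    omega
  have hQeq := eq_of_subset_of_card_le hsub (hle.trans hQ3)
  obtain ⟨a, ha, b, hb, hab⟩ := one_lt_card.1 (show 1 < #{y ∈ R | G.Adj x y} from h1)
  rw [mem_filter] at ha hb
  have haQ : a ∈ Q := hQeq ▸ mem_filter.2 ⟨mem_union_right _ ha.1, ha.2⟩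
  have hbQ : b ∈ Q := hQeq ▸ mem_filter.2 ⟨mem_union_right _ hb.1, hb.2⟩
  have hQc : #Q = 3 := le_antisymm (hQeq ▸ hle) hQ3
  have hcard := hmin {x, a, b}
    (isRim_triangle ha.2 hb.2 (hQ.adj_of_card_eq_three hQc haQ hbQ hab)) (by
      simp only [mem_insert, mem_singleton]
      rintro y (rfl | rfl | rfl)
      exacts [hv _ hx, hv _ ha.1, hv _ hb.1])
  have := hcard.trans card_le_three
  omega

/-- A set `S` can be enlarged by some `t ≥ 1` vertices at the price of `growthCost t` edges. The
number `c` stands for a missing edge from the new vertex `v` to `S`: it is `1` for `S = ∅`. -/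
lemma exists_growth (hG : ∀ v, ∃ R : Finset V, G.IsRim R ∧ ∀ x ∈ R, G.Adj v x)
    {S : Finset V} {v : V} (hv : v ∉ S) {c : ℕ} (hc : 1 ≤ G.degIn v S + c) :
    ∃ (A : Finset V) (t : ℕ), 1 ≤ t ∧ #A = #S + t ∧
      G.degSum S + 2 * growthCost t ≤ G.degSum A + 2 * c := by
  classical
  obtain ⟨R, ⟨hR, hvR⟩, hmin⟩ : ∃ R : Finset V, (G.IsRim R ∧ ∀ x ∈ R, G.Adj v x) ∧
      ∀ P : Finset V, G.IsRim P → (∀ y ∈ P, G.Adj v y) → #R ≤ #P := by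
    obtain ⟨R, hR, h⟩ := (measure (card : Finset V → ℕ)).wf.has_min
      {R | G.IsRim R ∧ ∀ x ∈ R, G.Adj v x} (hG v)
    exact ⟨R, hR, fun P h1 h2 ↦ not_lt.1 (h P ⟨h1, h2⟩)⟩
  have hvv : v ∉ R := fun h ↦ (hvR v h).ne rfl
  have h3 := hR.three_le_card
  have hvA : v ∈ insert v S := mem_insert_self v S
  have hsd : R \ insert v S = R \ S := by
    rw [sdiff_insert, erase_eq_of_notMem fun h ↦ hvv (mem_sdiff.1 h).1]
  have hA1 : G.degSum (insert v S) = _ := degSum_insert hv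
  have hcard1 : #(insert v S) = _ := card_insert_of_notMem hv
  have hcard : #(insert v S ∪ R) = #S + (1 + #(R \ S)) := by
    rw [← union_sdiff_self_eq_union, card_union_of_disjoint disjoint_sdiff, hsd, hcard1, add_assoc]
  have hgrow := hR.degSum_add_le hvA hvR
  rw [hsd] at hgrow
  have hsplit := card_sdiff_add_card_inter R S
  rcases (R ∩ S).eq_empty_or_nonempty with hRS | hRS
  · rw [hRS, card_empty, add_zero] at hsplit
    rw [hsplit] at hcard hgrow
    by_cases h45 : #R = 3 ∨ 6 ≤ #R
    · have := growthCost_le_two_mul_sub_one (t := 1 + #R) (by omega)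
      exact ⟨_, _, by omega, hcard, by omega⟩
    -- The wheel has five or six vertices and misses `S`; its bound is short by one edge, which a
    -- second rim, around a vertex `x` of the first, has to make up for.
    obtain ⟨x, hx⟩ := hR.nonempty
    obtain ⟨Q, hQ, hxQ⟩ := hG x
    have hQ3 := hQ.three_le_card
    have hxA : x ∈ insert v S ∪ R := mem_union_right _ hx
    rcases (Q \ (insert v S ∪ R)).eq_empty_or_nonempty with hd | hd
    · have hdisj : Disjoint R (insert v S) := by
        rw [disjoint_insert_right]
        exact ⟨hvv, disjoint_iff_inter_eq_empty.2 hRS⟩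
      have hfive := hR.five_le_of_subset hvA hvR (by omega) hmin hx hdisj hQ hxQ
        (sdiff_eq_empty_iff_subset.1 hd)
      have := hR.degSum_add_le_of_five_le hvA hvR
        (by rwa [sdiff_eq_self_of_disjoint hdisj]) hfive
      rw [hsd, hsplit] at this
      have := growthCost_le_two_mul (t := 1 + #R) (by omega)
      exact ⟨_, _, by omega, hcard, by omega⟩
    · have hcard2 : #(insert v S ∪ R ∪ Q) = #S + (1 + #R + #(Q \ (insert v S ∪ R))) := by
        rw [← union_sdiff_self_eq_union (s := insert v S ∪ R),
          card_union_of_disjoint disjoint_sdiff, hcard, add_assoc]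
      refine ⟨_, _, by omega, hcard2, ?_⟩
      rcases (Q ∩ (insert v S ∪ R)).eq_empty_or_nonempty with hi | hi
      · have h1 := hQ.degSum_add_le hxA hxQ
        have h2 := card_sdiff_add_card_inter Q (insert v S ∪ R)
        rw [hi, card_empty] at h2
        have := growthCost_le_two_mul_sub_one (t := 1 + #R + #(Q \ (insert v S ∪ R))) (by omega)
        omega
      · have h1 := hQ.degSum_add_le_of_inter_nonempty hxA hxQ hd hi
        have := growthCost_le_two_mul (t := 1 + #R + #(Q \ (insert v S ∪ R))) (by omega)
        omega
  · refine ⟨_, _, by omega, hcard, ?_⟩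
    have hdv : #(R ∩ S) ≤ G.degIn v S := by
      rw [← G.degIn_eq_card fun y hy ↦ hvR y (mem_inter.1 hy).1]
      exact G.degIn_mono v inter_subset_right
    rcases (R \ S).eq_empty_or_nonempty with hd | hd
    · rw [hd, card_empty] at *
      have : growthCost (1 + 0) = 3 := rfl
      omega
    · have h1 := hR.degSum_add_le_of_inter_nonempty hvA hvR (by rwa [hsd])
        (hRS.mono (inter_subset_inter_left (subset_insert v S)))
      rw [hsd] at h1
      have h2 := hd.card_pos
      have h4 := hRS.card_pos
      by_cases ht : #(R \ S) = 1
      · rw [ht] at *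
        have : growthCost (1 + 1) = 5 := rfl
        omega
      · have := growthCost_le_two_mul (t := 1 + #(R \ S)) (by omega)
        omega

lemma Connected.exists_adj_of_ne_univ [Fintype V] (hG : G.Connected) {S : Finset V}
    (hS : S.Nonempty) (hSu : S ≠ univ) : ∃ v, v ∉ S ∧ 0 < G.degIn v S := by
  obtain ⟨x, hx⟩ := hS
  obtain ⟨z, -, hz⟩ := exists_of_ssubset (ssubset_univ_iff.2 hSu)
  obtain ⟨p⟩ := hG.preconnected x z
  obtain ⟨d, -, hd1, hd2⟩ := p.exists_boundary_dart (S : Set V) hx hz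
  exact ⟨d.snd, hd2, G.degIn_pos hd1 d.adj.symm⟩

theorem LocallyNonforesty.pSize_le_ncard_edgeSet [Fintype V] (hG : G.LocallyNonforesty)
    (hconn : G.Connected) : pSize (Fintype.card V) ≤ G.edgeSet.ncard := by
  classical
  have hrim := hG.exists_isRim
  obtain ⟨v⟩ := hconn.nonempty
  let good : Finset (Finset V) :=
    {S | S.Nonempty ∧ 2 * growthCost #S ≤ G.degSum S + 2}
  have hgood : good.Nonempty := by
    obtain ⟨A, t, ht, hA, h⟩ := exists_growth hrim (notMem_empty v) (c := 1) (by omega)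
    have h0 : G.degSum ∅ = 0 := rfl
    rw [card_empty, zero_add] at hA
    refine ⟨A, mem_filter.2 ⟨mem_univ _, card_pos.1 (by omega), ?_⟩⟩
    rw [hA]
    omega
  obtain ⟨S, hS, hmax⟩ := good.exists_max_image card hgood
  obtain ⟨-, hne, hcost⟩ := mem_filter.1 hS
  have hSu : S = univ := by
    by_contra hSu
    obtain ⟨w, hw, hdeg⟩ := hconn.exists_adj_of_ne_univ hne hSu
    obtain ⟨A, t, ht, hA, h⟩ := exists_growth hrim hw (c := 0) (by omega)
    have hsub := growthCost_add_le #S t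
    have := hmax A <| mem_filter.2 ⟨mem_univ _, card_pos.1 (by omega), by rw [hA]; omega⟩
    omega
  rw [hSu, degSum_univ, card_univ, ← pSize_add_one (Fintype.card_pos_iff.2 ⟨v⟩)] at hcost
  omega

end SimpleGraph

/-! ### The extremal graph -/

namespace SimpleGraph

variable {V : Type*}

open Finset

/-- The graph on the natural numbers whose restriction to `{0, …, n - 1}` is extremal: the blocks of
four consecutive numbers starting at a multiple of `4` are complete, consecutive numbers are
adjacent, and the last four vertices `n - 4, …, n - 1` are complete as well. -/
def blockChain (n : ℕ) : SimpleGraph ℕ where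
  Adj i j := i ≠ j ∧ (i / 4 = j / 4 ∨ i + 1 = j ∨ j + 1 = i ∨ n ≤ i + 4 ∧ n ≤ j + 4)
  symm := ⟨fun i j h ↦ by omega⟩
  loopless := ⟨fun i h ↦ h.1 rfl⟩

/-- The number of neighbors `i < j` of `j < n` in `blockChain n`, for `4 ≤ n`; they are
the numbers just below `j`. -/
def blockChainDeg (n j : ℕ) : ℕ :=
  if j = 0 then 0 else if j < 4 * (n / 4) then max 1 (j % 4) else 4 + j - n

lemma blockChain_adj_of_lt {n i j : ℕ} (hij : i < j) (hj : j < n) (h : (blockChain n).Adj i j) :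
    j - 1 - i < blockChainDeg n j := by
  obtain ⟨-, h⟩ := h
  unfold blockChainDeg
  split_ifs <;> omega

lemma sum_blockChainDeg_four_mul (n k : ℕ) (hk : 1 ≤ k) (hkn : k ≤ n / 4) :
    ∑ j ∈ range (4 * k), blockChainDeg n j = 7 * k - 1 := by
  induction k, hk using Nat.le_induction with
  | base =>
    have h0 : blockChainDeg n 0 = 0 := rfl
    have h1 : blockChainDeg n 1 = 1 := by unfold blockChainDeg; split_ifs <;> omega
    have h2 : blockChainDeg n 2 = 2 := by unfold blockChainDeg; split_ifs <;> omega
    have h3 : blockChainDeg n 3 = 3 := by unfold blockChainDeg; split_ifs <;> omega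
    simp only [mul_one, sum_range_succ, sum_range_zero, h0, h1, h2, h3]
  | succ k hk ih =>
    rw [mul_add, mul_one, sum_range_add, ih (by omega)]
    have h0 : blockChainDeg n (4 * k + 0) = 1 := by unfold blockChainDeg; split_ifs <;> omega
    have h1 : blockChainDeg n (4 * k + 1) = 1 := by unfold blockChainDeg; split_ifs <;> omega
    have h2 : blockChainDeg n (4 * k + 2) = 2 := by unfold blockChainDeg; split_ifs <;> omega
    have h3 : blockChainDeg n (4 * k + 3) = 3 := by unfold blockChainDeg; split_ifs <;> omega
    simp only [sum_range_succ, sum_range_zero, h0, h1, h2, h3]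
    omega

lemma sum_blockChainDeg {n : ℕ} (hn : 4 ≤ n) : ∑ j ∈ range n, blockChainDeg n j = pSize n := by
  have hd (s : ℕ) : blockChainDeg n (4 * (n / 4) + s) = 4 + (4 * (n / 4) + s) - n := by
    unfold blockChainDeg
    split_ifs <;> omega
  have hsplit : ∑ j ∈ range n, blockChainDeg n j =
      ∑ j ∈ range (4 * (n / 4)), blockChainDeg n j +
        ∑ s ∈ range (n % 4), blockChainDeg n (4 * (n / 4) + s) := by
    rw [← sum_range_add, Nat.div_add_mod]
  rw [hsplit, sum_blockChainDeg_four_mul n (n / 4) (by omega) le_rfl]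
  simp only [hd]
  have h4 : n % 4 = 0 ∨ n % 4 = 1 ∨ n % 4 = 2 ∨ n % 4 = 3 := by omega
  rcases h4 with h | h | h | h <;> rw [h] <;>
    simp only [sum_range_succ, sum_range_zero] <;> unfold pSize <;> split_ifs <;> omega

/-- A vertex of a `K₄` has a triangle in its neighborhood. -/
lemma exists_isCycle_localSubgraph {G : SimpleGraph V} {v a b c : V} (hva : G.Adj v a)
    (hvb : G.Adj v b) (hvc : G.Adj v c) (hab : G.Adj a b) (hbc : G.Adj b c) (hca : G.Adj c a) :
    ∃ (u : G.neighborSet v) (c : (G.localSubgraph v).Walk u u), c.IsCycle := by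
  have h1 : (G.localSubgraph v).Adj ⟨a, hva⟩ ⟨b, hvb⟩ := hab
  have h2 : (G.localSubgraph v).Adj ⟨b, hvb⟩ ⟨c, hvc⟩ := hbc
  have h3 : (G.localSubgraph v).Adj ⟨c, hvc⟩ ⟨a, hva⟩ := hca
  refine ⟨⟨a, hva⟩, .cons h1 (.cons h2 (.cons h3 .nil)), ?_⟩
  simp [Walk.cons_isCycle_iff, h1.ne, h1.ne', h2.ne, h3.ne, h3.ne']

variable {n : ℕ} (e : V ≃ Fin n)

/-- The extremal graph on a type with `n` elements, numbered by `e`. -/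
def extremalGraph : SimpleGraph V := (blockChain n).comap fun x ↦ (e x : ℕ)

lemma extremalGraph_connected (hn : 0 < n) : (extremalGraph e).Connected := by
  have hreach : ∀ i (hi : i < n),
      (extremalGraph e).Reachable (e.symm ⟨0, hn⟩) (e.symm ⟨i, hi⟩) := by
    intro i
    induction i with
    | zero => exact fun _ ↦ .refl _
    | succ i ih =>
      refine fun hi ↦ (ih (by omega)).trans (Adj.reachable ?_)
      simp [extremalGraph, blockChain]
  refine (connected_iff_exists_forall_reachable _).2 ⟨e.symm ⟨0, hn⟩, fun x ↦ ?_⟩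
  simpa using hreach (e x) (e x).2

lemma extremalGraph_locallyNonforesty (hn : 4 ≤ n) : (extremalGraph e).LocallyNonforesty := by
  intro v
  have hv := (e v).2
  obtain ⟨B, hB, hB1, hB2, hadj⟩ : ∃ B, B ≤ (e v : ℕ) ∧ (e v : ℕ) < B + 4 ∧ B + 4 ≤ n ∧
      ∀ i j, i < 4 → j < 4 → i ≠ j → (blockChain n).Adj (B + i) (B + j) := by
    by_cases h : (e v : ℕ) / 4 < n / 4
    · exact ⟨4 * ((e v : ℕ) / 4), by omega, by omega, by omega,
        fun i j hi hj hij ↦ ⟨by omega, by omega⟩⟩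
    · exact ⟨n - 4, by omega, by omega, by omega, fun i j hi hj hij ↦ ⟨by omega, by omega⟩⟩
  obtain ⟨s, hs⟩ := Nat.exists_eq_add_of_le hB
  have hlt (t : ℕ) : B + (s + t) % 4 < n := by omega
  have hedge (t u : ℕ) (h : (s + t) % 4 ≠ (s + u) % 4) :
      (extremalGraph e).Adj (e.symm ⟨_, hlt t⟩) (e.symm ⟨_, hlt u⟩) := by
    simpa [extremalGraph] using hadj _ _ (by omega) (by omega) h
  have hv0 : v = e.symm ⟨_, hlt 0⟩ := by
    rw [Equiv.eq_symm_apply]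
    ext
    simp only
    omega
  have hv' (t : ℕ) (h : (s + 0) % 4 ≠ (s + t) % 4) :
      (extremalGraph e).Adj v (e.symm ⟨_, hlt t⟩) := by
    conv_lhs => rw [hv0]
    exact hedge 0 t h
  exact exists_isCycle_localSubgraph (hv' 1 (by omega)) (hv' 2 (by omega)) (hv' 3 (by omega))
    (hedge 1 2 (by omega)) (hedge 2 3 (by omega)) (hedge 3 1 (by omega))

lemma extremalGraph_ncard_edgeSet_le (hn : 4 ≤ n) :
    (extremalGraph e).edgeSet.ncard ≤ pSize n := by
  classical
  have hinj : Function.Injective fun x ↦ (e x : ℕ) := Fin.val_injective.comp e.injective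
  rw [← Set.ncard_image_of_injective _ (Sym2.map.injective hinj)]
  let P := (range n).sigma fun j ↦ range (blockChainDeg n j)
  have hP : #P = pSize n := by
    rw [card_sigma]
    simpa using sum_blockChainDeg hn
  rw [← hP]
  refine (Set.ncard_le_ncard (t := P.image fun p ↦ s(p.1 - 1 - p.2, p.1)) ?_
    (finite_toSet _)).trans ((Set.ncard_coe_finset _).trans_le card_image_le)
  have key (x y : V) (h : (extremalGraph e).Adj x y) (hxy : (e x : ℕ) < e y) :
      s((e x : ℕ), (e y : ℕ)) ∈ P.image fun p ↦ s(p.1 - 1 - p.2, p.1) := by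
    refine mem_image.2 ⟨⟨e y, e y - 1 - e x⟩, mem_sigma.2 ⟨mem_range.2 (e y).2, mem_range.2 ?_⟩, ?_⟩
    · exact blockChain_adj_of_lt hxy (e y).2 h
    · have : (e y : ℕ) - 1 - (e y - 1 - e x) = e x := by omega
      simp only [this]
  rintro _ ⟨z, hz, rfl⟩
  induction z with
  | _ x y =>
    rw [mem_edgeSet] at hz
    rcases lt_or_gt_of_ne (hinj.ne hz.ne) with hxy | hxy
    · exact key x y hz hxy
    · rw [Sym2.map_mk, Sym2.eq_swap]
      exact key y x hz.symm hxy

end SimpleGraph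

theorem theorem4 (n : ℕ) (hn : 8 ≤ n) {V : Type*} [Fintype V] (hV : Fintype.card V = n) :
    IsLeast {m : ℕ | ∃ G : SimpleGraph V,
      G.Connected ∧ G.LocallyNonforesty ∧ G.edgeSet.ncard = m} (pSize n) := by
  refine ⟨?_, ?_⟩
  · have e := Fintype.equivFinOfCardEq hV
    have hconn := SimpleGraph.extremalGraph_connected e (by omega)
    have hloc := SimpleGraph.extremalGraph_locallyNonforesty e (by omega)
    exact ⟨_, hconn, hloc, (SimpleGraph.extremalGraph_ncard_edgeSet_le e (by omega)).antisymm
      (hV ▸ hloc.pSize_le_ncard_edgeSet hconn)⟩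
  · rintro m ⟨G, hconn, hloc, rfl⟩
    exact hV ▸ hloc.pSize_le_ncard_edgeSet hconn
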